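/- Let $M$ be a closed (compact, without boundary) oriented spin $7$-manifold with a Riemannian metric $g$, and let $SM \to M$ be its real spinor bundle, of rank $8$, with its induced Euclidean metric $g^{SM}$ and the spin connection $\nabla^{SM}$ induced by the Levi-Civita connection of $g$; orient $SM$ (by either orientation). Let $\pi : SM \to M$ be the projection, $Y$ the tautological section of $\pi^*SM \to SM$ and $\widehat Y$ the corresponding element of the exterior algebra of $\pi^*SM$. Let $\nabla^{\pi^*SM}Y$ be regarded as an element of $\Omega^1(SM;\pi^*\Lambda^1 SM)$, and regard the curvature $R$ of $\nabla^{SM}$ as an element of $\Omega^2(M;\Lambda^2 SM)$ through $A \mapsto \frac14\sum_{a,c}\langle e_a, A e_c\rangle\, \hat e_a\wedge \hat e_c$ for skew $A$, where $(e_a)$ is an orthonormal basis of the fibre. Let $\int^B : \Omega^\bullet(SM;\pi^*\Lambda^\bullet SM)\to\Omega^\bullet(SM)$ be the Berezin integral, which for an oriented orthonormal basis $e_1,\dots,e_8$ sends $\alpha\wedge\hat e_1\wedge\dots\wedge\hat e_8$ to $\pi^{-4}\alpha$ (here $\pi$ is the number) and vanishes on components of lower degree in $\Lambda^\bullet SM$.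 The Mathai–Quillen current, a smooth $7$-form off the zero section of $SM$, is $$\psi(\nabla^{SM},g^{SM}) = \int_0^\infty \int^B \frac{\widehat Y}{2\sqrt t}\; \exp\bigl(-(\pi^*R + \sqrt t\,\nabla^{\pi^*SM}Y + t\,\|Y\|^2)\bigr)\, dt .$$ Let $s$ be a smooth, nowhere vanishing section of $SM$. If $s$ is parallel, that is, $\nabla^{SM}s = 0$, then the $7$-form $s^*\psi(\nabla^{SM},g^{SM})$ is integrable and $$\int_M s^*\psi(\nabla^{SM},g^{SM}) = 0 .$$ -/

import Mathlib

open Bundle Manifold MeasureTheory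
open scoped ContDiff Manifold Topology

noncomputable section

/-! ### Super-exterior algebra and the Berezin integral (linear algebra at one point) -/

namespace MQ

section Algebra

/-- `Λ(V*) ⊗̂ Λ(W)`, the graded tensor product of the algebra of forms on `V` with the exterior
algebra of `W`, realised as `Λ(V* ⊕ W)`.  Elements of `V*` and of `W` anticommute. -/
abbrev SuperForm (V W : Type*) [AddCommGroup V] [Module ℝ V] [AddCommGroup W] [Module ℝ W] :
    Type _ :=
  ExteriorAlgebra ℝ (Module.Dual ℝ V × W)

variable {V W : Type*} [AddCommGroup V] [Module ℝ V]

/-- A covector `α ∈ V*` as an element of bidegree `(1, 0)`. -/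
def covec [AddCommGroup W] [Module ℝ W] (α : Module.Dual ℝ V) : SuperForm V W :=
  ExteriorAlgebra.ι ℝ (α, 0)

/-- A vector `w ∈ W` as an element `ŵ` of bidegree `(0, 1)`. -/
def hat [AddCommGroup W] [Module ℝ W] (w : W) : SuperForm V W :=
  ExteriorAlgebra.ι ℝ (0, w)

/-- A `W`-valued one-form `θ` on `V` as the element `∑ᵢ bⁱ ∧ θ(bᵢ)^` of bidegree `(1, 1)`, where
`b` is any basis of `V`. -/
def oneFormElt [FiniteDimensional ℝ V] [AddCommGroup W] [Module ℝ W] (θ : V →ₗ[ℝ] W) :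
    SuperForm V W :=
  ∑ i, covec ((Module.finBasis ℝ V).coord i) * hat (θ (Module.finBasis ℝ V i))

variable [NormedAddCommGroup W] [InnerProductSpace ℝ W] {r : ℕ}

/-- A two-form `R` on `V` with values in the skew endomorphisms of the Euclidean space `W` as the
element of bidegree `(2, 2)`
`½ ∑_{i,j} bⁱ ∧ bʲ ∧ (¼ ∑_{a,c} ⟨e_a, R(b_i, b_j) e_c⟩ ê_a ∧ ê_c)`,
where `b` is any basis of `V` and `e` any orthonormal basis of `W`.  The identification
`A ↦ ¼ ∑ ⟨e_a, A e_c⟩ ê_a ∧ ê_c` of `𝔰𝔬(W)` with `Λ²W` is the one normalised such that the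
contraction of `A` with `w` is `-½ A w`, as needed for the transgression formula
`dψ = π^*e - δ₀`. -/
def twoFormElt [FiniteDimensional ℝ V] (e : OrthonormalBasis (Fin r) ℝ W) (R : V → V → W → W) :
    SuperForm V W :=
  (2⁻¹ : ℝ) • ∑ i, ∑ j, covec ((Module.finBasis ℝ V).coord i) *
    covec ((Module.finBasis ℝ V).coord j) *
      ((4⁻¹ : ℝ) • ∑ a, ∑ c,
        inner ℝ (e a) (R (Module.finBasis ℝ V i) (Module.finBasis ℝ V j) (e c)) •
          (hat (e a) * hat (e c)))

/-- The exponential `exp(z + a)` of the sum of a real number `z` and an element `a` of positive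
form degree.  All powers `a ^ k` with `k > dim V` vanish, so the exponential series is finite. -/
def superExp [FiniteDimensional ℝ V] (z : ℝ) (a : SuperForm V W) : SuperForm V W :=
  Real.exp z • ∑ k ∈ Finset.range (Module.finrank ℝ V + 1), ((k.factorial : ℝ)⁻¹ • a ^ k)

/-- The linear form `(α, w) ↦ ⟨e_a, w⟩` on `V* ⊕ W`. -/
def coordW (V : Type*) [AddCommGroup V] [Module ℝ V] (e : OrthonormalBasis (Fin r) ℝ W)
    (a : Fin r) : Module.Dual ℝ (Module.Dual ℝ V × W) :=
  (e.toBasis.coord a) ∘ₗ LinearMap.snd ℝ _ _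

/-- The Berezin integral `∫^B : Λ(V*) ⊗̂ Λ(W) → Λ(V*)`.  For an oriented orthonormal basis
`e₁, …, e_r` of `W` it sends `α ∧ ê₁ ∧ ⋯ ∧ ê_r` to `(-1)^{r(r+1)/2} π^{-r/2} α` and kills
all other components.  The coefficient of `ê₁ ∧ ⋯ ∧ ê_r` is obtained by contracting from the
right with `e_r`, …, `e₁` and then projecting `Λ(V* ⊕ W)` to `Λ(V*)`. -/
def berezin (e : OrthonormalBasis (Fin r) ℝ W) :
    SuperForm V W →ₗ[ℝ] ExteriorAlgebra ℝ (Module.Dual ℝ V) :=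
  ((-1 : ℝ) ^ (r * (r + 1) / 2) * (√Real.pi ^ r)⁻¹) •
    ((ExteriorAlgebra.map (LinearMap.fst ℝ (Module.Dual ℝ V) W)).toLinearMap ∘ₗ
      (List.finRange r).foldr
        (fun a f => (CliffordAlgebra.contractRight (Q := 0)).flip (coordW V e a) ∘ₗ f)
        LinearMap.id)

/-- The degree `q` component of an element of `Λ(V*)` as an alternating form on `V`:
`(α₁ ∧ ⋯ ∧ α_q)(v₁, …, v_q) = det (α_j(v_i))`. -/
def toAlternating (q : ℕ) : ExteriorAlgebra ℝ (Module.Dual ℝ V) →ₗ[ℝ] V [⋀^Fin q]→ₗ[ℝ] ℝ :=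
  exteriorPower.alternatingMapLinearEquiv.symm.toLinearMap ∘ₗ
    exteriorPower.pairingDual ℝ V q ∘ₗ
      DirectSum.component ℝ ℕ (fun i => ⋀[ℝ]^i (Module.Dual ℝ V)) q ∘ₗ
        (DirectSum.decomposeLinearEquiv (fun i => ⋀[ℝ]^i (Module.Dual ℝ V))).toLinearMap

/-- The integrand `∫^B Ŷ / (2√t) · exp(-(R + √t θ + t ‖Y‖²))` at one point. -/
def mqIntegrand [FiniteDimensional ℝ V] (e : OrthonormalBasis (Fin r) ℝ W)
    (R θ : SuperForm V W) (Y : W) (t : ℝ) : ExteriorAlgebra ℝ (Module.Dual ℝ V) :=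
  berezin e ((2 * √t)⁻¹ • (hat Y * superExp (-(t * ‖Y‖ ^ 2)) (-(R + √t • θ))))

theorem exists_pow_expansion {A : Type*} [Ring A] [Algebra ℝ A] (x y : A) (k : ℕ) :
    ∃ c : ℕ → A, ∀ u : ℝ, (-(x + u • y)) ^ k = ∑ j ∈ Finset.range (k + 1), u ^ j • c j := by
  induction k with
  | zero => exact ⟨fun _ => 1, fun u => by simp⟩
  | succ k ih =>
    obtain ⟨c, hc⟩ := ih
    refine ⟨fun j => (if j < k + 1 then c j * (-x) else 0) +
      (if j = 0 then 0 else c (j - 1) * (-y)), fun u => ?_⟩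
    have h1 : ∑ j ∈ Finset.range (k + 1 + 1),
        u ^ j • (if j < k + 1 then c j * (-x) else 0) =
        ∑ j ∈ Finset.range (k + 1), u ^ j • (c j * (-x)) := by
      rw [Finset.sum_range_succ, if_neg (lt_irrefl _), smul_zero, add_zero]
      exact Finset.sum_congr rfl fun j hj => by rw [if_pos (Finset.mem_range.1 hj)]
    have h2 : ∑ j ∈ Finset.range (k + 1 + 1),
        u ^ j • (if j = 0 then 0 else c (j - 1) * (-y)) =
        ∑ j ∈ Finset.range (k + 1), u ^ (j + 1) • (c j * (-y)) := by
      rw [Finset.sum_range_succ']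
      simp
    simp only [smul_add, Finset.sum_add_distrib]
    rw [h1, h2, pow_succ, hc u, neg_add, mul_add, Finset.sum_mul, Finset.sum_mul]
    congr 1
    · exact Finset.sum_congr rfl fun j _ => by rw [smul_mul_assoc]
    · exact Finset.sum_congr rfl fun j _ => by
        rw [smul_mul_assoc, pow_succ, mul_smul, ← smul_neg, mul_smul_comm]

theorem integrableOn_mqIntegrand [FiniteDimensional ℝ V] (e : OrthonormalBasis (Fin r) ℝ W)
    (R θ : SuperForm V W) (Y : W) (l : ExteriorAlgebra ℝ (Module.Dual ℝ V) →ₗ[ℝ] ℝ) :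
    IntegrableOn (fun t => l (mqIntegrand e R θ Y t)) (Set.Ioi 0) := by
  by_cases hY : Y = 0
  · have : hat (V := V) Y = 0 := by
      subst hY; exact map_zero (ExteriorAlgebra.ι ℝ)
    simp [mqIntegrand, this]
  choose c hc using fun k : ℕ => exists_pow_expansion R θ k
  have hb : 0 < ‖Y‖ ^ 2 := by positivity
  have key : ∀ j : ℕ, IntegrableOn
      (fun t : ℝ => (√t)⁻¹ * (√t) ^ j * Real.exp (-(t * ‖Y‖ ^ 2))) (Set.Ioi 0) := by
    intro j
    have := integrableOn_rpow_mul_exp_neg_mul_rpow (p := 1) (s := -(1/2) + (1/2) * j)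
      (b := ‖Y‖ ^ 2) (by have : (0 : ℝ) ≤ j := j.cast_nonneg
                         linarith) one_pos hb
    refine this.congr_fun (fun t ht => ?_) measurableSet_Ioi
    have ht' : (0 : ℝ) < t := ht
    simp only [Real.rpow_one]
    rw [Real.rpow_add ht', Real.rpow_neg ht'.le, Real.rpow_mul ht'.le, Real.rpow_natCast,
      ← Real.sqrt_eq_rpow]
    ring_nf
  have hexp : ∀ t : ℝ, l (mqIntegrand e R θ Y t) =
      ∑ k ∈ Finset.range (Module.finrank ℝ V + 1), ∑ j ∈ Finset.range (k + 1),
        (2⁻¹ * (k.factorial : ℝ)⁻¹ * l (berezin e (hat Y * c k j))) *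
          ((√t)⁻¹ * (√t) ^ j * Real.exp (-(t * ‖Y‖ ^ 2))) := by
    intro t
    simp only [mqIntegrand, superExp, hc, Finset.mul_sum, Finset.smul_sum, map_sum, map_smul,
      mul_smul_comm, smul_eq_mul, mul_inv]
    refine Finset.sum_congr rfl fun k _ => Finset.sum_congr rfl fun j _ => ?_
    ring
  simp only [hexp]
  exact integrable_finsetSum _ fun k _ => integrable_finsetSum _ fun j _ =>
    (key j).const_mul _

/-- `∫₀^∞ ∫^B Ŷ / (2√t) · exp(-(R + √t θ + t ‖Y‖²)) dt`, degree `q` component, as an alternating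
form; the integral over `t` is taken coefficientwise and converges absolutely. -/
def mqForm [FiniteDimensional ℝ V] (q : ℕ) (e : OrthonormalBasis (Fin r) ℝ W)
    (R θ : SuperForm V W) (Y : W) : V [⋀^Fin q]→ₗ[ℝ] ℝ where
  toFun v := ∫ t in Set.Ioi (0 : ℝ), toAlternating q (mqIntegrand e R θ Y t) v
  map_update_add' v i x y := by
    have h (w : Fin q → V) :
        IntegrableOn (fun t => toAlternating q (mqIntegrand e R θ Y t) w) (Set.Ioi 0) :=
      integrableOn_mqIntegrand e R θ Y
        { toFun := fun z => toAlternating q z w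
          map_add' := fun _ _ => by simp
          map_smul' := fun _ _ => by simp }
    simp only [AlternatingMap.map_update_add]
    exact integral_add (h _) (h _)
  map_update_smul' v i a x := by
    simp only [AlternatingMap.map_update_smul, smul_eq_mul]
    exact integral_const_mul _ _
  map_eq_zero_of_eq' v i j hv hij := by
    simp [AlternatingMap.map_eq_zero_of_eq _ v hv hij]

end Algebra

/-! ### Connections, curvature and orientations of vector bundles -/

section Bundles

variable {E : Type*} [NormedAddCommGroup E] [NormedSpace ℝ E]
  {H : Type*} [TopologicalSpace H] {I : ModelWithCorners ℝ E H}
  {M : Type*} [TopologicalSpace M] [ChartedSpace H M]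
  {F : Type*} [NormedAddCommGroup F] [NormedSpace ℝ F]
  {S : M → Type*} [TopologicalSpace (TotalSpace F S)]
  [∀ x, NormedAddCommGroup (S x)] [∀ x, InnerProductSpace ℝ (S x)]
  [FiberBundle F S] [VectorBundle ℝ F S]

/-- The curvature `R(u, v) w = ∇_U ∇_V σ - ∇_V ∇_U σ - ∇_[U, V] σ` at `x`, where `U`, `V`, `σ` are
local extensions of `u`, `v`, `w` (the ones that are constant in the preferred trivialisation
around `x`; the result does not depend on the extensions). -/
def curvature [IsManifold I 1 M] (cov : CovariantDerivative I F S) (x : M)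
    (u v : TangentSpace I x) (w : S x) : S x :=
  cov (fun y => cov (FiberBundle.extend F w) y (FiberBundle.extend E v y)) x u
    - cov (fun y => cov (FiberBundle.extend F w) y (FiberBundle.extend E u y)) x v
    - cov (FiberBundle.extend F w) x
        (VectorField.mlieBracket I (FiberBundle.extend E u) (FiberBundle.extend E v) x)

section Pullback

variable {E' : Type*} [NormedAddCommGroup E'] [NormedSpace ℝ E']
  {H' : Type*} [TopologicalSpace H'] (I' : ModelWithCorners ℝ E' H')
  {N : Type*} [TopologicalSpace N] [ChartedSpace H' N]

/-- The pullback connection `∇^{f^*S}` applied to a section `τ` of `f^*S`, for `f : N → M`.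
In a trivialisation of `S` around `f p` with frame `(b_i)` write `τ = ∑ yⁱ f^*b_i`; then
`∇^{f^*S} τ = ∑ dyⁱ ⊗ b_i + ∑ yⁱ ∇_{df(·)} b_i` at `p`. -/
def pullbackCov (cov : CovariantDerivative I F S) (f : N → M) (τ : ∀ p, S (f p)) (p : N) :
    TangentSpace I' p →L[ℝ] S (f p) :=
  ((trivializationAt F S (f p)).symmL ℝ (f p)).comp
      (mfderiv I' 𝓘(ℝ, F) (fun q => (trivializationAt F S (f p) ⟨f q, τ q⟩).2) p) +
    (cov (FiberBundle.extend F (τ p)) (f p)).comp (mfderiv I' I f p)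

end Pullback

/-- A section of the orientation bundle is continuous if it is locally constant in the preferred
trivialisations. -/
def IsContinuousOrientation {n : ℕ} (F : Type*) [NormedAddCommGroup F] [NormedSpace ℝ F]
    {V : M → Type*} [TopologicalSpace (TotalSpace F V)] [∀ x, TopologicalSpace (V x)]
    [∀ x, AddCommGroup (V x)] [∀ x, Module ℝ (V x)] [FiberBundle F V] [VectorBundle ℝ F V]
    (o : ∀ x, Orientation ℝ (V x) (Fin n)) : Prop :=
  ∀ x₀ : M, ∃ oF : Orientation ℝ F (Fin n), ∀ᶠ x in 𝓝 x₀,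
    ∀ hx : x ∈ (trivializationAt F V x₀).baseSet,
      Orientation.map (Fin n)
        ((trivializationAt F V x₀).continuousLinearEquivAt ℝ x hx).toLinearEquiv (o x) = oF

end Bundles

/-! ### The Mathai-Quillen form on the total space of an oriented Euclidean bundle -/

section MathaiQuillen

variable {E : Type*} [NormedAddCommGroup E] [NormedSpace ℝ E] [FiniteDimensional ℝ E]
  {H : Type*} [TopologicalSpace H] {I : ModelWithCorners ℝ E H}
  {M : Type*} [TopologicalSpace M] [ChartedSpace H M] [IsManifold I 1 M]
  {r : ℕ} [NeZero r]
  {S : M → Type*} [TopologicalSpace (TotalSpace (EuclideanSpace ℝ (Fin r)) S)]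
  [∀ x, NormedAddCommGroup (S x)] [∀ x, InnerProductSpace ℝ (S x)]
  [FiberBundle (EuclideanSpace ℝ (Fin r)) S] [VectorBundle ℝ (EuclideanSpace ℝ (Fin r)) S]

/-- An oriented orthonormal basis of the fibre `S x`. -/
def fibreBasis (o : ∀ x, Orientation ℝ (S x) (Fin r)) (x : M) :
    OrthonormalBasis (Fin r) ℝ (S x) :=
  (o x).finOrthonormalBasis (Nat.pos_of_neZero r)
    ((VectorBundle.finrank_eq ℝ (EuclideanSpace ℝ (Fin r)) S x).trans finrank_euclideanSpace_fin)

instance (p : TotalSpace (EuclideanSpace ℝ (Fin r)) S) :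
    FiniteDimensional ℝ (TangentSpace (I.prod 𝓘(ℝ, EuclideanSpace ℝ (Fin r))) p) :=
  inferInstanceAs (FiniteDimensional ℝ (E × EuclideanSpace ℝ (Fin r)))

/-- The Mathai-Quillen current of an oriented Euclidean bundle `π : S → M` with connection `∇`,
as a form on the total space (smooth off the zero section, where it is set to be zero):
`ψ = ∫₀^∞ ∫^B Ŷ / (2√t) · exp(-(π^*R + √t ∇^{π^*S} Ŷ + t ‖Y‖²)) dt`,
where `Y` is the tautological section of `π^*S`; here its component of degree `q`. -/
def mathaiQuillen (q : ℕ) (cov : CovariantDerivative I (EuclideanSpace ℝ (Fin r)) S)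
    (o : ∀ x, Orientation ℝ (S x) (Fin r)) (p : TotalSpace (EuclideanSpace ℝ (Fin r)) S) :
    TangentSpace (I.prod 𝓘(ℝ, EuclideanSpace ℝ (Fin r))) p [⋀^Fin q]→ₗ[ℝ] ℝ :=
  let dπ := mfderiv (I.prod 𝓘(ℝ, EuclideanSpace ℝ (Fin r))) I
    (TotalSpace.proj : TotalSpace (EuclideanSpace ℝ (Fin r)) S → M) p
  mqForm q (fibreBasis o p.proj)
    (twoFormElt (fibreBasis o p.proj) fun u v => curvature cov p.proj (dπ u) (dπ v))
    (oneFormElt (pullbackCov (I.prod 𝓘(ℝ, EuclideanSpace ℝ (Fin r))) cov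
      (TotalSpace.proj : TotalSpace (EuclideanSpace ℝ (Fin r)) S → M) (fun Y => Y.snd)
        p).toLinearMap)
    p.snd

/-- The pullback `s^*ψ` of a form on the total space by a section `s`. -/
def pullbackForm {q : ℕ}
    (ψ : ∀ p : TotalSpace (EuclideanSpace ℝ (Fin r)) S,
      TangentSpace (I.prod 𝓘(ℝ, EuclideanSpace ℝ (Fin r))) p [⋀^Fin q]→ₗ[ℝ] ℝ)
    (s : ∀ x, S x) (x : M) : TangentSpace I x [⋀^Fin q]→ₗ[ℝ] ℝ :=
  (ψ ⟨x, s x⟩).compLinearMap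
    (mfderiv I (I.prod 𝓘(ℝ, EuclideanSpace ℝ (Fin r)))
      (fun y => (⟨y, s y⟩ : TotalSpace (EuclideanSpace ℝ (Fin r)) S)) x).toLinearMap

end MathaiQuillen

/-! ### Integration of top-degree forms over closed oriented manifolds -/

section Integration

variable {n : ℕ} {M : Type*} [TopologicalSpace M] [ChartedSpace (EuclideanSpace ℝ (Fin n)) M]

/-- The coordinate frame `∂₁, …, ∂ₙ` of the chart at `c`, at the point with coordinates `y`. -/
def coordFrame (c : M) (y : EuclideanSpace ℝ (Fin n)) (i : Fin n) :
    TangentSpace (𝓡 n) ((extChartAt (𝓡 n) c).symm y) :=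
  mfderiv (𝓡 n) (𝓡 n) (extChartAt (𝓡 n) c).symm y (EuclideanSpace.single i (1 : ℝ))

/-- The function `± α(∂₁, …, ∂ₙ)` in the coordinates of the chart at `c`, with the sign `+` where
the coordinates are positively oriented and `-` where they are negatively oriented. -/
def coordDensity (o : ∀ x : M, Orientation ℝ (TangentSpace (𝓡 n) x) (Fin n))
    (α : ∀ x : M, TangentSpace (𝓡 n) x [⋀^Fin n]→ₗ[ℝ] ℝ) (c : M)
    (y : EuclideanSpace ℝ (Fin n)) : ℝ :=
  (SignType.sign ((o ((extChartAt (𝓡 n) c).symm y)).someVector (coordFrame c y)) : ℝ) *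
    α ((extChartAt (𝓡 n) c).symm y) (coordFrame c y)

variable [IsManifold (𝓡 n) ∞ M] [T2Space M] [CompactSpace M]

variable (n M) in
/-- A smooth partition of unity subordinate to the covering by chart domains. -/
def chartPartition : SmoothPartitionOfUnity M (𝓡 n) M Set.univ :=
  (SmoothPartitionOfUnity.exists_isSubordinate_chartAt_source (𝓡 n) M).choose

/-- A form of top degree is integrable if, for each of the finitely many non-zero functions `ρ_c`
of the partition of unity, `ρ_c α` is integrable in the coordinates of the chart at `c`. -/
def FormIntegrable (o : ∀ x : M, Orientation ℝ (TangentSpace (𝓡 n) x) (Fin n))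
    (α : ∀ x : M, TangentSpace (𝓡 n) x [⋀^Fin n]→ₗ[ℝ] ℝ) : Prop :=
  ∀ c : M, IntegrableOn
    (fun y => chartPartition n M c ((extChartAt (𝓡 n) c).symm y) * coordDensity o α c y)
    (extChartAt (𝓡 n) c).target

/-- The integral `∫_M α` of a form of top degree over a closed oriented manifold. -/
def formIntegral (o : ∀ x : M, Orientation ℝ (TangentSpace (𝓡 n) x) (Fin n))
    (α : ∀ x : M, TangentSpace (𝓡 n) x [⋀^Fin n]→ₗ[ℝ] ℝ) : ℝ :=
  ∑ᶠ c : M, ∫ y in (extChartAt (𝓡 n) c).target,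
    chartPartition n M c ((extChartAt (𝓡 n) c).symm y) * coordDensity o α c y

end Integration

/-! ### Spinor bundles of oriented Riemannian 7-manifolds -/

section Spin

variable {M : Type*} [TopologicalSpace M] [ChartedSpace (EuclideanSpace ℝ (Fin 7)) M]
  [IsManifold (𝓡 7) ∞ M]
  [RiemannianBundle (fun x : M => TangentSpace (𝓡 7) x)]

set_option synthInstance.maxHeartbeats 400000 in
/-- The Levi-Civita connection: torsion free and compatible with the metric. -/
structure IsLeviCivita
    [IsContMDiffRiemannianBundle (𝓡 7) ∞ (EuclideanSpace ℝ (Fin 7))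
      (fun x : M => TangentSpace (𝓡 7) x)]
    (cov : CovariantDerivative (𝓡 7) (EuclideanSpace ℝ (Fin 7))
      (fun x : M => TangentSpace (𝓡 7) x)) : Prop where
  torsion_free : cov.torsion = 0
  metric : cov.IsMetricCompatible

variable (S : M → Type*) [TopologicalSpace (TotalSpace (EuclideanSpace ℝ (Fin 8)) S)]
  [∀ x, NormedAddCommGroup (S x)] [∀ x, InnerProductSpace ℝ (S x)]
  [FiberBundle (EuclideanSpace ℝ (Fin 8)) S] [VectorBundle ℝ (EuclideanSpace ℝ (Fin 8)) S]

/-- The structure of a real spinor bundle on a Euclidean vector bundle `S` of rank 8 over an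
oriented Riemannian 7-manifold `M`: a smooth orthogonal Clifford multiplication, so that every
fibre is the irreducible real module `Δ` of the Clifford algebra of `T_xM` on which the oriented
volume element acts by a fixed sign.  Pairs `(A, B)` of an oriented isometry `A : ℝ⁷ → T_xM` and
an isometry `B : Δ → S x` intertwining the Clifford multiplications are a torsor under `Spin(7)`,
and they form a principal `Spin(7)`-bundle `P` that doubly covers the oriented orthonormal frame
bundle, with `S = P ×_{Spin(7)} Δ`.  So this is the same as a spin structure on `M` together with
its real spinor bundle `SM` and its metric `g^{SM}`. -/
structure SpinorBundle (o : ∀ x : M, Orientation ℝ (TangentSpace (𝓡 7) x) (Fin 7)) where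
  /-- Clifford multiplication `T_xM → End(S x)`. -/
  c : ∀ x : M, TangentSpace (𝓡 7) x →L[ℝ] S x →L[ℝ] S x
  smooth_c : ContMDiff (𝓡 7)
    ((𝓡 7).prod 𝓘(ℝ, EuclideanSpace ℝ (Fin 7) →L[ℝ]
      EuclideanSpace ℝ (Fin 8) →L[ℝ] EuclideanSpace ℝ (Fin 8))) ∞
    (fun x => TotalSpace.mk' (EuclideanSpace ℝ (Fin 7) →L[ℝ]
      EuclideanSpace ℝ (Fin 8) →L[ℝ] EuclideanSpace ℝ (Fin 8))
      (E := fun x : M => TangentSpace (𝓡 7) x →L[ℝ] S x →L[ℝ] S x) x (c x))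
  clifford : ∀ (x : M) (v : TangentSpace (𝓡 7) x) (σ : S x), c x v (c x v σ) = -(‖v‖ ^ 2) • σ
  skew : ∀ (x : M) (v : TangentSpace (𝓡 7) x) (σ τ : S x),
    inner ℝ (c x v σ) τ = -inner ℝ σ (c x v τ)
  volume : ∃ ε : ℝ, (ε = 1 ∨ ε = -1) ∧
    ∀ (x : M) (e : OrthonormalBasis (Fin 7) ℝ (TangentSpace (𝓡 7) x)),
      e.toBasis.orientation = o x → ∀ σ : S x,
        c x (e 0) (c x (e 1) (c x (e 2) (c x (e 3) (c x (e 4) (c x (e 5) (c x (e 6) σ)))))) = ε • σ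

variable {S}

/-- The spin connection `∇^{SM}` induced by the Levi-Civita connection `∇`: the unique connection
that is compatible with the metric of `S` and satisfies
`∇^{SM}_u (X · σ) = (∇_u X) · σ + X · ∇^{SM}_u σ`. -/
structure IsSpinConnection {o : ∀ x : M, Orientation ℝ (TangentSpace (𝓡 7) x) (Fin 7)}
    [ContMDiffVectorBundle ∞ (EuclideanSpace ℝ (Fin 8)) S (𝓡 7)]
    [IsContMDiffRiemannianBundle (𝓡 7) ∞ (EuclideanSpace ℝ (Fin 8)) S]
    (P : SpinorBundle S o)
    (covT : CovariantDerivative (𝓡 7) (EuclideanSpace ℝ (Fin 7))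
      (fun x : M => TangentSpace (𝓡 7) x))
    (covS : CovariantDerivative (𝓡 7) (EuclideanSpace ℝ (Fin 8)) S) : Prop where
  metric : covS.IsMetricCompatible
  clifford : ∀ (x : M) (X : ∀ y : M, TangentSpace (𝓡 7) y) (σ : ∀ y, S y),
    MDifferentiableAt (𝓡 7) ((𝓡 7).prod 𝓘(ℝ, EuclideanSpace ℝ (Fin 7)))
      (fun y => TotalSpace.mk' (EuclideanSpace ℝ (Fin 7))
        (E := fun x : M => TangentSpace (𝓡 7) x) y (X y)) x →
    MDifferentiableAt (𝓡 7) ((𝓡 7).prod 𝓘(ℝ, EuclideanSpace ℝ (Fin 8)))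
      (fun y => TotalSpace.mk' (EuclideanSpace ℝ (Fin 8)) y (σ y)) x →
    ∀ u : TangentSpace (𝓡 7) x,
      covS (fun y => P.c y (X y) (σ y)) x u = P.c x (covT X x u) (σ x) + P.c x (X x) (covS σ x u)

end Spin

end MQ

end

/-! The form `s^*ψ` vanishes at every point, so its integrability and integral are immediate. The
pullback of `∇Y` along `s` is `∇s = 0`, so the pulled-back integrand is `ŝ / (2√t)` times the
exponential of `-(R + t‖s‖²)`. Since `R` has form degree two, only even form degrees survive, and
the degree 7 component is zero for each `t`.

Parity is detected by a sign argument instead of a grading. Let `A` be the differential of `s`. Both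
`A` and `-A` kill `∇Y`, and they pull `R` back to the same element, so they pull the integrand back
to the same form. In odd degree `q` they differ by `(-1)^q = -1`, and the form is zero: this is
`toAlternating_mqIntegrand_comp_eq_zero`. It relies on the naturality of the Berezin integral
(`map_dualMap_berezin`). The geometric input is `pullbackCov_snd_mfderiv_section`, which identifies
the pullback of `∇Y` with `∇s`. -/

namespace MQ

/-! ### Naturality of super-forms and of the Berezin integral under linear pullback; the parity
argument. -/

section Naturality

theorem map_contractRight {M N : Type*} [AddCommGroup M] [Module ℝ M] [AddCommGroup N] [Module ℝ N]
    (f : M →ₗ[ℝ] N) (d : Module.Dual ℝ N) (z : ExteriorAlgebra ℝ M) :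
    ExteriorAlgebra.map f (CliffordAlgebra.contractRight (Q := 0) z (d ∘ₗ f)) =
      CliffordAlgebra.contractRight (Q := 0) (ExteriorAlgebra.map f z) d := by
  induction z using CliffordAlgebra.right_induction with
  | algebraMap r =>
    rw [CliffordAlgebra.contractRight_algebraMap, map_zero]
    erw [AlgHom.commutes, CliffordAlgebra.contractRight_algebraMap]
  | add x y hx hy => simp only [map_add, LinearMap.add_apply, hx, hy]
  | mul_ι m x hx =>
    have hm : ExteriorAlgebra.map f (CliffordAlgebra.ι 0 m) = CliffordAlgebra.ι 0 (f m) :=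
      ExteriorAlgebra.map_apply_ι f m
    rw [CliffordAlgebra.contractRight_mul_ι, map_sub, map_smul, map_mul, map_mul, hx, hm,
      CliffordAlgebra.contractRight_mul_ι]
    rfl

variable {V V' W : Type*} [AddCommGroup V] [Module ℝ V] [AddCommGroup V'] [Module ℝ V']

theorem toAlternating_ιMulti_self (q : ℕ) (φ : Fin q → Module.Dual ℝ V) (v : Fin q → V) :
    toAlternating q (ExteriorAlgebra.ιMulti ℝ q φ) v =
      (Matrix.of fun i j => φ j (v i)).det := by
  have h : DirectSum.decompose (fun i => ⋀[ℝ]^i (Module.Dual ℝ V))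
      (ExteriorAlgebra.ιMulti ℝ q φ) q = exteriorPower.ιMulti ℝ q φ :=
    Subtype.ext (DirectSum.decompose_of_mem_same _ (exteriorPower.ιMulti ℝ q φ).2)
  have h' : toAlternating q (ExteriorAlgebra.ιMulti ℝ q φ) v =
      exteriorPower.pairingDual ℝ V q (DirectSum.decompose (fun i => ⋀[ℝ]^i (Module.Dual ℝ V))
      (ExteriorAlgebra.ιMulti ℝ q φ) q) (exteriorPower.ιMulti ℝ q v) := rfl
  rw [h', h, exteriorPower.pairingDual_ιMulti_ιMulti]

theorem toAlternating_ιMulti_of_ne {n q : ℕ} (h : n ≠ q) (φ : Fin n → Module.Dual ℝ V) :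
    toAlternating q (ExteriorAlgebra.ιMulti ℝ n φ) = 0 := by
  have h1 : DirectSum.decompose (fun i => ⋀[ℝ]^i (Module.Dual ℝ V))
      (ExteriorAlgebra.ιMulti ℝ n φ) q = 0 :=
    Subtype.ext (DirectSum.decompose_of_mem_ne _ (exteriorPower.ιMulti ℝ n φ).2 h)
  have h' : toAlternating q (ExteriorAlgebra.ιMulti ℝ n φ) =
      exteriorPower.alternatingMapLinearEquiv.symm (exteriorPower.pairingDual ℝ V q
        (DirectSum.decompose (fun i => ⋀[ℝ]^i (Module.Dual ℝ V))
      (ExteriorAlgebra.ιMulti ℝ n φ) q)) := rfl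
  rw [h', h1, map_zero, map_zero]

/-- The pullback of forms along `A` is the functorial map of the exterior algebra. -/
theorem toAlternating_compLinearMap (q : ℕ) (A : V' →ₗ[ℝ] V)
    (z : ExteriorAlgebra ℝ (Module.Dual ℝ V)) :
    (toAlternating q z).compLinearMap A =
      toAlternating q (ExteriorAlgebra.map A.dualMap z) := by
  -- Both sides are linear in `z`, and products of covectors span, so only determinants need
  -- comparing.
  have hz : z ∈ Submodule.span ℝ (Set.range fun x : Σ n, (Fin n → Module.Dual ℝ V) =>
      ExteriorAlgebra.ιMulti ℝ x.1 x.2) := ExteriorAlgebra.ιMulti_span ℝ (Module.Dual ℝ V) ▸ trivial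
  induction hz using Submodule.span_induction with
  | mem z h =>
    obtain ⟨⟨n, φ⟩, rfl⟩ := h
    simp only [ExteriorAlgebra.map_apply_ιMulti]
    by_cases h : n = q
    · subst h
      ext v
      simp only [AlternatingMap.compLinearMap_apply]
      erw [toAlternating_ιMulti_self, toAlternating_ιMulti_self]
      rfl
    · rw [toAlternating_ιMulti_of_ne h, toAlternating_ιMulti_of_ne h,
        AlternatingMap.zero_compLinearMap]
  | zero => simp
  | add x y _ _ hx hy => simp only [map_add, AlternatingMap.add_compLinearMap, hx, hy]
  | smul a x _ hx => rw [map_smul, map_smul, map_smul, ← hx]; rfl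

/-- The pullback `Λ(V*) ⊗̂ Λ(W) → Λ(V'*) ⊗̂ Λ(W)` along a linear map `A : V' → V`. -/
def pullbackSuper (W : Type*) [AddCommGroup W] [Module ℝ W] (A : V' →ₗ[ℝ] V) :
    SuperForm V W →ₐ[ℝ] SuperForm V' W :=
  ExteriorAlgebra.map (A.dualMap.prodMap LinearMap.id)

section
variable [AddCommGroup W] [Module ℝ W] (A : V' →ₗ[ℝ] V)

@[simp]
theorem pullbackSuper_covec (α : Module.Dual ℝ V) :
    pullbackSuper W A (covec α) = covec (α ∘ₗ A) := by
  rw [pullbackSuper, covec, ExteriorAlgebra.map_apply_ι]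
  rfl

@[simp]
theorem pullbackSuper_hat (w : W) : pullbackSuper W A (hat w) = hat w := by
  rw [pullbackSuper, hat, ExteriorAlgebra.map_apply_ι]
  simp [hat]

theorem covec_neg (α : Module.Dual ℝ V) : (covec (-α) : SuperForm V W) = -covec α := by
  rw [covec, covec, ← map_neg, Prod.neg_mk, neg_zero]

theorem covec_sum_smul {ι : Type*} (s : Finset ι) (a : ι → ℝ) (α : ι → Module.Dual ℝ V) :
    (covec (∑ i ∈ s, a i • α i) : SuperForm V W) = ∑ i ∈ s, a i • covec (α i) := by
  have h : ∀ β : Module.Dual ℝ V, (covec β : SuperForm V W) =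
      (ExteriorAlgebra.ι ℝ ∘ₗ LinearMap.inl ℝ (Module.Dual ℝ V) W) β := fun _ => rfl
  simp only [h, map_sum, map_smul]

theorem hat_sum_smul {ι : Type*} (s : Finset ι) (a : ι → ℝ) (w : ι → W) :
    (hat (∑ i ∈ s, a i • w i) : SuperForm V W) = ∑ i ∈ s, a i • hat (w i) := by
  have h : ∀ β : W, (hat β : SuperForm V W) =
      (ExteriorAlgebra.ι ℝ ∘ₗ LinearMap.inr ℝ (Module.Dual ℝ V) W) β := fun _ => rfl
  simp only [h, map_sum, map_smul]

/-- The element is the canonical tensor of `θ` in `V* ⊗ W`. Expanding `bⁱ ∘ A` in the dual basis of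
`b'`, and `θ (A b'_j)` in the vectors `θ b_i`, uses the same matrix `bⁱ(A b'_j)`; the two sides are
one double sum in different orders. -/
theorem pullbackSuper_oneFormElt [FiniteDimensional ℝ V] [FiniteDimensional ℝ V']
    (θ : V →ₗ[ℝ] W) :
    pullbackSuper W A (oneFormElt θ) = oneFormElt (θ ∘ₗ A) := by
  set b := Module.finBasis ℝ V
  set b' := Module.finBasis ℝ V'
  have hcov : ∀ i, b.coord i ∘ₗ A = ∑ j, b.coord i (A (b' j)) • b'.coord j := fun i =>
    b'.ext fun k => by
      simp [Finsupp.single_apply]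
  have hhat : ∀ j, θ (A (b' j)) = ∑ i, b.coord i (A (b' j)) • θ (b i) := fun j => by
    conv_lhs => rw [← b.sum_repr (A (b' j)), map_sum]
    simp only [map_smul, Module.Basis.coord_apply]
  simp only [oneFormElt, map_sum, map_mul, pullbackSuper_covec, pullbackSuper_hat,
    LinearMap.comp_apply]
  change ∑ i, covec (b.coord i ∘ₗ A) * hat (θ (b i)) =
    ∑ j, covec (b'.coord j) * hat (θ (A (b' j)))
  simp only [hcov, hhat, covec_sum_smul, hat_sum_smul, Finset.sum_mul, Finset.mul_sum,
    smul_mul_assoc, mul_smul_comm]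
  exact Finset.sum_comm

end

variable [NormedAddCommGroup W] [InnerProductSpace ℝ W] {r : ℕ}

/-- Each term contains two covectors, so the signs cancel. No formula for the pullback itself is
needed; with `R` a mere function it need not be `twoFormElt` of `R` composed with `A`. -/
theorem pullbackSuper_twoFormElt_neg [FiniteDimensional ℝ V] (A : V' →ₗ[ℝ] V)
    (e : OrthonormalBasis (Fin r) ℝ W) (R : V → V → W → W) :
    pullbackSuper W (-A) (twoFormElt e R) = pullbackSuper W A (twoFormElt e R) := by
  simp only [twoFormElt, map_smul, map_sum, map_mul, pullbackSuper_covec, pullbackSuper_hat,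
    LinearMap.comp_neg, covec_neg, neg_mul_neg]

theorem pullbackSuper_contractRight_coordW (A : V' →ₗ[ℝ] V) (e : OrthonormalBasis (Fin r) ℝ W)
    (a : Fin r) (z : SuperForm V W) :
    pullbackSuper W A ((CliffordAlgebra.contractRight (Q := 0)).flip (coordW V e a) z) =
      (CliffordAlgebra.contractRight (Q := 0)).flip (coordW V' e a) (pullbackSuper W A z) := by
  have h : coordW V e a = coordW V' e a ∘ₗ A.dualMap.prodMap LinearMap.id := rfl
  rw [LinearMap.flip_apply, LinearMap.flip_apply, h]
  exact map_contractRight _ _ z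

theorem map_dualMap_map_fst (A : V' →ₗ[ℝ] V) (z : SuperForm V W) :
    ExteriorAlgebra.map A.dualMap
      (ExteriorAlgebra.map (LinearMap.fst ℝ (Module.Dual ℝ V) W) z) =
      ExteriorAlgebra.map (LinearMap.fst ℝ (Module.Dual ℝ V') W) (pullbackSuper W A z) := by
  have h : A.dualMap ∘ₗ LinearMap.fst ℝ (Module.Dual ℝ V) W =
      LinearMap.fst ℝ (Module.Dual ℝ V') W ∘ₗ A.dualMap.prodMap LinearMap.id := rfl
  rw [pullbackSuper, ← AlgHom.comp_apply, ← AlgHom.comp_apply, ExteriorAlgebra.map_comp_map,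
    ExteriorAlgebra.map_comp_map, h]

/-- The contractions involve only `W` and the pullback acts only on `V*`, so the two operations
commute. -/
theorem map_dualMap_berezin (A : V' →ₗ[ℝ] V) (e : OrthonormalBasis (Fin r) ℝ W)
    (z : SuperForm V W) :
    ExteriorAlgebra.map A.dualMap (berezin e z) = berezin e (pullbackSuper W A z) := by
  -- An arbitrary list replaces `List.finRange r` to permit induction.
  have hfold : ∀ l : List (Fin r),
      pullbackSuper W A (l.foldr
        (fun a f => (CliffordAlgebra.contractRight (Q := 0)).flip (coordW V e a) ∘ₗ f)
        LinearMap.id z) =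
      l.foldr (fun a f => (CliffordAlgebra.contractRight (Q := 0)).flip (coordW V' e a) ∘ₗ f)
        LinearMap.id (pullbackSuper W A z) := by
    intro l
    induction l with
    | nil => rfl
    | cons a l ih =>
      rw [List.foldr_cons, List.foldr_cons, LinearMap.comp_apply, LinearMap.comp_apply, ← ih]
      exact pullbackSuper_contractRight_coordW A e a _
  rw [berezin, berezin, LinearMap.smul_apply, LinearMap.smul_apply, map_smul,
    LinearMap.comp_apply, LinearMap.comp_apply, ← hfold, AlgHom.toLinearMap_apply,
    AlgHom.toLinearMap_apply]
  exact congrArg _ (map_dualMap_map_fst A _)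

/-- If the pullback of `θ` vanishes, the pullback of the Mathai-Quillen integrand only involves
forms of even degree. -/
theorem toAlternating_mqIntegrand_comp_eq_zero [FiniteDimensional ℝ V] [FiniteDimensional ℝ V']
    {q : ℕ} (hq : Odd q) (e : OrthonormalBasis (Fin r) ℝ W) (R : V → V → W → W)
    (θ : V →ₗ[ℝ] W) (Y : W) (t : ℝ) (A : V' →ₗ[ℝ] V) (hA : θ ∘ₗ A = 0) (v : Fin q → V') :
    toAlternating q (mqIntegrand e (twoFormElt e R) (oneFormElt θ) Y t) (fun i => A (v i)) = 0 := by
  set z := mqIntegrand e (twoFormElt e R) (oneFormElt θ) Y t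
  have hθ : ∀ B : V' →ₗ[ℝ] V, θ ∘ₗ B = 0 → pullbackSuper W B (oneFormElt θ) = 0 := fun B hB => by
    rw [pullbackSuper_oneFormElt, hB]
    have h0 : (hat 0 : SuperForm V' W) = 0 := map_zero (ExteriorAlgebra.ι ℝ)
    simp [oneFormElt, h0]
  -- With `θ` killed, the result depends on `B` only through the pullback of `R`. The series stays
  -- truncated at `dim V`, not `dim V'`, so it is left as an explicit sum.
  have hmap : ∀ B : V' →ₗ[ℝ] V, θ ∘ₗ B = 0 → ExteriorAlgebra.map B.dualMap z =
      berezin e ((2 * √t)⁻¹ • (hat Y * (Real.exp (-(t * ‖Y‖ ^ 2)) •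
        ∑ k ∈ Finset.range (Module.finrank ℝ V + 1),
          ((k.factorial : ℝ)⁻¹ • (-pullbackSuper W B (twoFormElt e R)) ^ k)))) := fun B hB => by
    simp only [z, mqIntegrand, superExp, map_dualMap_berezin, map_smul, map_mul, map_sum, map_pow,
      map_neg, map_add, pullbackSuper_hat, hθ B hB, smul_zero, add_zero]
  have hneg : ExteriorAlgebra.map (-A).dualMap z = ExteriorAlgebra.map A.dualMap z := by
    rw [hmap _ hA, hmap (-A) (by rw [LinearMap.comp_neg, hA, neg_zero]),
      pullbackSuper_twoFormElt_neg]
  have h1 : (toAlternating q z).compLinearMap (-A) v = (toAlternating q z).compLinearMap A v := by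
    rw [toAlternating_compLinearMap, toAlternating_compLinearMap, hneg]
  -- Multilinearity extracts `(-1)^q = -1`; with `h1` the value equals its own negative.
  have h2 : (toAlternating q z).compLinearMap (-A) v =
      -(toAlternating q z).compLinearMap A v := by
    have := (toAlternating q z).map_smul_univ (fun _ => (-1 : ℝ)) (fun i => A (v i))
    simpa [hq.neg_one_pow] using this
  have h3 : (toAlternating q z).compLinearMap A v = 0 := by linarith
  exact h3

theorem mqForm_compLinearMap_eq_zero [FiniteDimensional ℝ V] [FiniteDimensional ℝ V']
    {q : ℕ} (hq : Odd q) (e : OrthonormalBasis (Fin r) ℝ W) (R : V → V → W → W)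
    (θ : V →ₗ[ℝ] W) (Y : W) (A : V' →ₗ[ℝ] V) (hA : θ ∘ₗ A = 0) :
    (mqForm q e (twoFormElt e R) (oneFormElt θ) Y).compLinearMap A = 0 := by
  ext v
  change ∫ t in Set.Ioi (0 : ℝ), toAlternating q
    (mqIntegrand e (twoFormElt e R) (oneFormElt θ) Y t) (fun i => A (v i)) = 0
  simp only [toAlternating_mqIntegrand_comp_eq_zero hq e R θ Y _ A hA, integral_zero]

end Naturality

end MQ

namespace MQ

/-! ### The covariant derivative in a trivialisation, and the pullback of `∇Y` along a section. -/

section Bundles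

variable {E : Type*} [NormedAddCommGroup E] [NormedSpace ℝ E]
  {H : Type*} [TopologicalSpace H] {I : ModelWithCorners ℝ E H}
  {M : Type*} [TopologicalSpace M] [ChartedSpace H M]
  {F : Type*} [NormedAddCommGroup F] [NormedSpace ℝ F]
  {S : M → Type*} [TopologicalSpace (TotalSpace F S)]
  [∀ x, NormedAddCommGroup (S x)] [∀ x, InnerProductSpace ℝ (S x)]
  [FiberBundle F S] [VectorBundle ℝ F S]

/-- In the preferred trivialisation, `∇ σ = dσ + Γ σ`, where `Γ σ` depends only on `σ x`. -/
theorem covariantDerivative_eq_add_extend [IsManifold I 1 M] [FiniteDimensional ℝ F]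
    [ContMDiffVectorBundle 1 F S I]
    (cov : CovariantDerivative I F S) {σ : ∀ x, S x} {x : M}
    (hσ : MDifferentiableAt I (I.prod 𝓘(ℝ, F)) (fun y => TotalSpace.mk' F y (σ y)) x) :
    cov σ x = ((trivializationAt F S x).symmL ℝ x).comp
        (mvfderiv I (fun y => (trivializationAt F S x ⟨y, σ y⟩).2) x) +
      cov (FiberBundle.extend F (σ x)) x := by
  set t := trivializationAt F S x
  have hx : x ∈ t.baseSet := FiberBundle.mem_baseSet_trivializationAt F S x
  have hbase : ∀ᶠ y in 𝓝 x, y ∈ t.baseSet := t.open_baseSet.mem_nhds hx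
  have hcoord {τ : ∀ y, S y}
      (hτ : MDifferentiableAt I (I.prod 𝓘(ℝ, F)) (fun y => TotalSpace.mk' F y (τ y)) x) :
      MDifferentiableAt I 𝓘(ℝ, F) (fun y => (t ⟨y, τ y⟩).2) x :=
    (mdifferentiableAt_section I τ).1 hτ
  have hcongr {f g : M → F} (h : f =ᶠ[𝓝 x] g) : mvfderiv I f x = mvfderiv I g x := by
    ext u
    change mfderiv I 𝓘(ℝ, F) f x u = mfderiv I 𝓘(ℝ, F) g x u
    rw [h.mfderiv_eq]
    rfl
  -- `∇` and the trivial connection of the trivialisation obey the same Leibniz rule, so their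
  -- difference is tensorial and its value at `x` depends only on `σ x`.
  let Φ : (∀ y, S y) → (TangentSpace I x →L[ℝ] S x) := fun τ =>
    cov τ x - (t.symmL ℝ x).comp (mvfderiv I (fun y => (t ⟨y, τ y⟩).2) x)
  have hΦ : TensorialAt I F Φ x := by
    refine ⟨fun {f τ} hf hτ => ?_, fun {τ τ'} hτ hτ' => ?_⟩
    · have heq : (fun y => (t ⟨y, (f • τ) y⟩).2) =ᶠ[𝓝 x] f • fun y => (t ⟨y, τ y⟩).2 :=
        hbase.mono fun y hy => (t.linear ℝ hy).map_smul (f y) (τ y)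
      have hsymm : t.symmL ℝ x (t ⟨x, τ x⟩).2 = τ x := by
        rw [t.symmL_apply hx, t.symm_apply_apply_mk hx]
      ext u
      simp only [Φ]
      rw [cov.isCovariantDerivativeOnUniv.leibniz hτ hf, hcongr heq, mvfderiv_smul hf (hcoord hτ)]
      simp [hsymm, smul_sub]
    · have heq : (fun y => (t ⟨y, (τ + τ') y⟩).2) =ᶠ[𝓝 x]
          (fun y => (t ⟨y, τ y⟩).2) + fun y => (t ⟨y, τ' y⟩).2 :=
        hbase.mono fun y hy => (t.linear ℝ hy).map_add (τ y) (τ' y)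
      simp only [Φ]
      rw [cov.isCovariantDerivativeOnUniv.add hτ hτ', hcongr heq,
        mvfderiv_add (hcoord hτ) (hcoord hτ'), ContinuousLinearMap.comp_add]
      abel
  have hext := hΦ.pointwise hσ (FiberBundle.mdifferentiableAt_extend I F (σ x))
    (FiberBundle.extend_apply_self (F := F) (σ x)).symm
  -- The extension of `σ x` is constant in the trivialisation, so on it `Φ` reduces to `cov`.
  have hconst : mvfderiv I (fun y => (t ⟨y, FiberBundle.extend F (σ x) y⟩).2) x = 0 := by
    have h : (fun y => (t ⟨y, FiberBundle.extend F (σ x) y⟩).2) =ᶠ[𝓝 x]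
        fun _ => (t ⟨x, σ x⟩).2 := hbase.mono fun y hy => by
      simp only [FiberBundle.extend]
      rw [t.apply_mk_symm hy]
    rw [hcongr h, mvfderiv_const]
  simp only [Φ] at hext
  rw [hconst, ContinuousLinearMap.comp_zero, sub_zero, sub_eq_iff_eq_add] at hext
  rw [hext, add_comm]

/-- The pullback along a section `σ` of the derivative of the tautological section is `∇ σ`. -/
theorem pullbackCov_snd_mfderiv_section [IsManifold I 1 M] [FiniteDimensional ℝ F]
    [ContMDiffVectorBundle 1 F S I]
    (cov : CovariantDerivative I F S) {σ : ∀ x, S x} {x : M}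
    (hσ : MDifferentiableAt I (I.prod 𝓘(ℝ, F)) (fun y => TotalSpace.mk' F y (σ y)) x)
    (u : TangentSpace I x) :
    pullbackCov (I.prod 𝓘(ℝ, F)) cov (TotalSpace.proj : TotalSpace F S → M) (fun Y => Y.snd)
      ⟨x, σ x⟩ (mfderiv I (I.prod 𝓘(ℝ, F)) (fun y => (⟨y, σ y⟩ : TotalSpace F S)) x u) =
    cov σ x u := by
  have hproj : MDifferentiableAt (I.prod 𝓘(ℝ, F)) I (TotalSpace.proj : TotalSpace F S → M)
      ⟨x, σ x⟩ := (contMDiff_proj (IB := I) (n := 1) S).mdifferentiableAt one_ne_zero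
  have htriv : MDifferentiableAt (I.prod 𝓘(ℝ, F)) 𝓘(ℝ, F)
      (fun q : TotalSpace F S => (trivializationAt F S x ⟨q.proj, q.snd⟩).2) ⟨x, σ x⟩ :=
    ((((trivializationAt F S x).contMDiffOn (IB := I) (n := 1)).contMDiffAt
      ((trivializationAt F S x).open_source.mem_nhds
        (FiberBundle.mem_trivializationAt_proj_source (x := ⟨x, σ x⟩)))).snd).mdifferentiableAt
          one_ne_zero
  -- The chain rule treats the two summands of `pullbackCov`: the fibre coordinate composed with `σ`
  -- is the local expression of `σ`, and the projection composed with `σ` is the identity.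
  have h1 := mfderiv_comp_apply x htriv hσ u
  have h2 := mfderiv_comp_apply x hproj hσ u
  have h3 : mfderiv I I ((TotalSpace.proj : TotalSpace F S → M) ∘
    fun y => TotalSpace.mk' F y (σ y)) x = ContinuousLinearMap.id ℝ (TangentSpace I x) :=
    mfderiv_id
  rw [h3] at h2
  rw [covariantDerivative_eq_add_extend cov hσ]
  exact congrArg₂ (fun a b => (trivializationAt F S x).symmL ℝ x a +
    cov (FiberBundle.extend F (σ x)) x b) h1.symm h2.symm

end Bundles

end MQ

/-! ### Pointwise vanishing for parallel sections, and the integral. -/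

namespace MQ
section
variable {E : Type*} [NormedAddCommGroup E] [NormedSpace ℝ E] [FiniteDimensional ℝ E]
  {H : Type*} [TopologicalSpace H] {I : ModelWithCorners ℝ E H}
  {M : Type*} [TopologicalSpace M] [ChartedSpace H M] [IsManifold I 1 M]
  {r : ℕ} [NeZero r]
  {S : M → Type*} [TopologicalSpace (TotalSpace (EuclideanSpace ℝ (Fin r)) S)]
  [∀ x, NormedAddCommGroup (S x)] [∀ x, InnerProductSpace ℝ (S x)]
  [FiberBundle (EuclideanSpace ℝ (Fin r)) S] [VectorBundle ℝ (EuclideanSpace ℝ (Fin r)) S]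

/-- The pullback of an odd-degree component of the Mathai-Quillen current by a parallel section
vanishes pointwise. -/
theorem pullbackForm_mathaiQuillen_eq_zero [ContMDiffVectorBundle 1 (EuclideanSpace ℝ (Fin r)) S I]
    {q : ℕ} (hq : Odd q) (cov : CovariantDerivative I (EuclideanSpace ℝ (Fin r)) S)
    (o : ∀ x, Orientation ℝ (S x) (Fin r)) {s : ∀ x, S x} {x : M}
    (hs : MDifferentiableAt I (I.prod 𝓘(ℝ, EuclideanSpace ℝ (Fin r)))
      (fun y => TotalSpace.mk' (EuclideanSpace ℝ (Fin r)) y (s y)) x)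
    (hpar : cov s x = 0) :
    pullbackForm (mathaiQuillen q cov o) s x = 0 := by
  have : FiniteDimensional ℝ (TangentSpace I x) := inferInstanceAs (FiniteDimensional ℝ E)
  -- With `A` the differential of `s`, what remains is that the pullback of `∇Y` vanishes.
  refine mqForm_compLinearMap_eq_zero hq _ _ _ _ _ (LinearMap.ext fun u => ?_)
  exact (pullbackCov_snd_mfderiv_section cov hs u).trans (by rw [hpar]; rfl)

end

end MQ

theorem lemma1p3
    {M : Type*} [TopologicalSpace M] [T2Space M] [CompactSpace M]
    [ChartedSpace (EuclideanSpace ℝ (Fin 7)) M] [IsManifold (𝓡 7) ∞ M]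
    [RiemannianBundle (fun x : M => TangentSpace (𝓡 7) x)]
    [IsContMDiffRiemannianBundle (𝓡 7) ∞ (EuclideanSpace ℝ (Fin 7))
      (fun x : M => TangentSpace (𝓡 7) x)]
    (oM : ∀ x : M, Orientation ℝ (TangentSpace (𝓡 7) x) (Fin 7))
    (hoM : MQ.IsContinuousOrientation (EuclideanSpace ℝ (Fin 7)) oM)
    {S : M → Type*} [TopologicalSpace (TotalSpace (EuclideanSpace ℝ (Fin 8)) S)]
    [∀ x, NormedAddCommGroup (S x)] [∀ x, InnerProductSpace ℝ (S x)]
    [FiberBundle (EuclideanSpace ℝ (Fin 8)) S] [VectorBundle ℝ (EuclideanSpace ℝ (Fin 8)) S]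
    [ContMDiffVectorBundle ∞ (EuclideanSpace ℝ (Fin 8)) S (𝓡 7)]
    [IsContMDiffRiemannianBundle (𝓡 7) ∞ (EuclideanSpace ℝ (Fin 8)) S]
    (P : MQ.SpinorBundle S oM)
    (oS : ∀ x, Orientation ℝ (S x) (Fin 8))
    (hoS : MQ.IsContinuousOrientation (EuclideanSpace ℝ (Fin 8)) oS)
    (covT : CovariantDerivative (𝓡 7) (EuclideanSpace ℝ (Fin 7))
      (fun x : M => TangentSpace (𝓡 7) x))
    (hcovT : MQ.IsLeviCivita covT)
    (covS : CovariantDerivative (𝓡 7) (EuclideanSpace ℝ (Fin 8)) S)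
    (hcovS : MQ.IsSpinConnection P covT covS)
    (s : ContMDiffSection (𝓡 7) (EuclideanSpace ℝ (Fin 8)) ∞ S)
    (hs : ∀ x, s x ≠ 0)
    (hpar : ∀ x, covS s x = 0) :
    MQ.FormIntegrable oM (MQ.pullbackForm (MQ.mathaiQuillen 7 covS oS) s) ∧
      MQ.formIntegral oM (MQ.pullbackForm (MQ.mathaiQuillen 7 covS oS) s) = 0 := by
  have hform : MQ.pullbackForm (MQ.mathaiQuillen 7 covS oS) s = fun _ => 0 := by
    have : ContMDiffVectorBundle 1 (EuclideanSpace ℝ (Fin 8)) S (𝓡 7) :=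
      ContMDiffVectorBundle.of_le (n := ∞) (by simp)
    have : IsManifold (𝓡 7) 1 M := IsManifold.of_le (n := ∞) (by simp)
    exact funext fun x => MQ.pullbackForm_mathaiQuillen_eq_zero (by decide) covS oS
      (s.contMDiff.mdifferentiable (by simp) x) (hpar x)
  -- The density of the zero form is an orientation sign times zero, whatever the sign.
  have hdens : ∀ c y, MQ.coordDensity oM
      (fun x : M => (0 : TangentSpace (𝓡 7) x [⋀^Fin 7]→ₗ[ℝ] ℝ)) c y = 0 := fun _ _ =>
    mul_zero _
  rw [hform]
  refine ⟨fun c => ?_, ?_⟩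
  · simp only [hdens, mul_zero]
    exact integrableOn_zero
  · simp only [MQ.formIntegral, hdens, mul_zero, integral_zero, finsum_zero]
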